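/- Let $k$ be a field, let $\Lambda$ be a finite dimensional Hopf algebra over $k$ and let $\Lambda'$ be a Hopf algebra over $k$ (Hopf algebras have an antipode; no bijectivity is required). Suppose that 1. $\Lambda$ is basic: each simple left $\Lambda$-module occurs with multiplicity one in the maximal semisimple quotient $\Lambda/\operatorname{rad}\Lambda$, regarded as a left $\Lambda$-module; 2. $\Lambda$ is split: for each simple left $\Lambda$-module $S$ the $k$-algebra $\operatorname{End}_\Lambda(S)$ is isomorphic to $k$; 3. $\Lambda$ and $\Lambda'$ are Morita-monoidally equivalent: there is a $k$-linear equivalence between the category of all left $\Lambda$-modules and the category of all left $\Lambda'$-modules which is a strong monoidal functor. Here the tensor product is $M\otimes_k N$ with the action through the comultiplication, $a(m\otimes n)=\sum a_{(1)}m\otimes a_{(2)}n$, the unit object is $k$ with the action through the counit, and the associativity and unit isomorphisms are those of $k$-vector spaces. Then $\Lambda$ and $\Lambda'$ are isomorphic as $k$-algebras. -/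

import Mathlib

universe u

section BasicSplit

/-- The multiplicity of the simple `R`-module `S` in the (semisimple) `R`-module `M`: the number
of simple summands of the `S`-isotypic component of `M`. -/
noncomputable def simpleMultiplicity (R M S : Type u) [Ring R] [AddCommGroup M] [Module R M]
    [AddCommGroup S] [Module R S] : ℕ∞ :=
  Module.length R (isotypicComponent R M S)

/-- A finite dimensional algebra `A` is basic if each simple `A`-module has multiplicity one in
the maximal semisimple quotient `A / rad A`. -/
def IsBasicAlgebra (A : Type u) [Ring A] : Prop :=
  ∀ (S : Type u) [AddCommGroup S] [Module A S], IsSimpleModule A S →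
    simpleMultiplicity A (A ⧸ Ring.jacobson A) S = 1

/-- A `k`-algebra `A` is split if the endomorphism ring of each simple `A`-module is reduced to
the ground field `k`. -/
def IsSplitAlgebra (k A : Type u) [Field k] [Ring A] [Algebra k A] : Prop :=
  ∀ (S : Type u) [AddCommGroup S] [Module k S] [Module A S] [IsScalarTower k A S],
    IsSimpleModule A S → Nonempty (Module.End A S ≃ₐ[k] k)

end BasicSplit

/-- A left module over the `k`-bialgebra `A` (the objects of the category of all left
`A`-modules). The `k`-vector space structure is recorded together with the `A`-module structure;
it is the one obtained by restriction along `k → A`. -/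
structure BialgModCat (k A : Type u) [Field k] [Ring A] [Bialgebra k A] where
  carrier : Type u
  [addCommGroup : AddCommGroup carrier]
  [moduleField : Module k carrier]
  [moduleAlgebra : Module A carrier]
  [isScalarTower : IsScalarTower k A carrier]

namespace BialgModCat

open CategoryTheory MonoidalCategory TensorProduct

attribute [instance] addCommGroup moduleField moduleAlgebra isScalarTower

variable {k A : Type u} [Field k] [Ring A] [Bialgebra k A]

instance : CoeSort (BialgModCat k A) (Type u) := ⟨carrier⟩

/-- Morphisms are the `A`-linear maps. -/
instance : Category.{u} (BialgModCat k A) where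
  Hom M N := M →ₗ[A] N
  id _ := LinearMap.id
  comp f g := g.comp f

instance : Preadditive (BialgModCat k A) where
  homGroup M N := inferInstanceAs (AddCommGroup (M →ₗ[A] N))
  add_comp _ _ _ f f' g := LinearMap.comp_add f f' g
  comp_add _ _ _ f g g' := LinearMap.add_comp f g' g

instance : Linear k (BialgModCat k A) where
  homModule M N := inferInstanceAs (Module k (M →ₗ[A] N))
  smul_comp M N P c f g := LinearMap.ext fun m =>
    (LinearMap.restrictScalars k (show N →ₗ[A] P from g)).map_smul c ((show M →ₗ[A] N from f) m)
  comp_smul _ _ _ _ _ _ := rfl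

section tensor

variable (M N : Type u) [AddCommGroup M] [AddCommGroup N] [Module k M] [Module k N]
  [Module A M] [Module A N] [IsScalarTower k A M] [IsScalarTower k A N]

/-- The representation of `A` on `M ⊗ N` given by
`A → A ⊗ A → End_k M ⊗ End_k N → End_k (M ⊗ N)`, the first map being the comultiplication:
`a • (m ⊗ n) = ∑ (a₁ • m) ⊗ (a₂ • n)`. -/
noncomputable def tensorAction : A →ₐ[k] Module.End k (M ⊗[k] N) :=
  (Module.endTensorEndAlgHom (R := k) (S := k) (A := k) (M := M) (N := N)).comp
    ((Algebra.TensorProduct.map (Algebra.lsmul k k M) (Algebra.lsmul k k N)).comp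
      (Bialgebra.comulAlgHom k A))

variable {M N}

variable (k A) in
theorem tensorAction_tmul (a : A) (m : M) (n : N) :
    tensorAction (k := k) M N a (m ⊗ₜ n) =
      TensorProduct.map ((LinearMap.toSpanSingleton A M m).restrictScalars k)
        ((LinearMap.toSpanSingleton A N n).restrictScalars k) (Coalgebra.comul (R := k) a) := by
  change Module.endTensorEndAlgHom (R := k) (S := k) (A := k) (M := M) (N := N)
    (Algebra.TensorProduct.map (Algebra.lsmul k k M) (Algebra.lsmul k k N)
      (Coalgebra.comul (R := k) a)) (m ⊗ₜ n) = _
  induction Coalgebra.comul (R := k) a with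
  | zero => simp
  | add u v hu hv => simp only [map_add, LinearMap.add_apply, hu, hv]
  | tmul u v => rfl

end tensor

/-- The tensor product over `k`, on which `A` acts through the comultiplication. -/
noncomputable def tensorObj (M N : BialgModCat k A) : BialgModCat k A where
  carrier := M ⊗[k] N
  moduleAlgebra := Module.compHom (M ⊗[k] N) (tensorAction (k := k) (A := A) M N).toRingHom
  isScalarTower := by
    let this := Module.compHom (M ⊗[k] N) (tensorAction (k := k) (A := A) M N).toRingHom
    refine @IsScalarTower.mk k A (M ⊗[k] N) _ this.toSMul _ fun c a x => ?_
    change tensorAction (k := k) M N (c • a) x = c • tensorAction (k := k) M N a x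
    rw [map_smul]; rfl

variable (k A) in
/-- The ground field, on which `A` acts through the counit. -/
noncomputable def unitObj : BialgModCat k A where
  carrier := k
  moduleAlgebra := Module.compHom k (Bialgebra.counitAlgHom k A).toRingHom
  isScalarTower := by
    let this := Module.compHom k (Bialgebra.counitAlgHom k A).toRingHom
    refine @IsScalarTower.mk k A k _ this.toSMul _ fun c a x => ?_
    change Coalgebra.counit (R := k) (c • a) * x = c * (Coalgebra.counit (R := k) a * x)
    rw [map_smul, smul_eq_mul, mul_assoc]

/-- The tensor product of two `A`-linear maps. -/
noncomputable def tensorMap {M M' N N' : BialgModCat k A} (f : M ⟶ M') (g : N ⟶ N') :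
    tensorObj M N ⟶ tensorObj M' N' :=
  { toFun := TensorProduct.map (LinearMap.restrictScalars k (f : M →ₗ[A] M'))
      (LinearMap.restrictScalars k (g : N →ₗ[A] N'))
    map_add' := map_add _
    map_smul' := fun a (x : M ⊗[k] N) => by
      change TensorProduct.map _ _ (tensorAction (k := k) M N a x) =
        tensorAction (k := k) M' N' a (TensorProduct.map _ _ x)
      induction x with
      | zero => simp
      | add x y hx hy => simp only [map_add, hx, hy]
      | tmul m n =>
        rw [TensorProduct.map_tmul, tensorAction_tmul, tensorAction_tmul,
          ← LinearMap.comp_apply, ← TensorProduct.map_comp]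
        congr 2 <;> ext <;> simp }

/-- An `A`-linear isomorphism from a `k`-linear one that commutes with the action of `A`. -/
def mkIso {M N : BialgModCat k A} (e : M ≃ₗ[k] N) (h : ∀ (a : A) (m : M), e (a • m) = a • e m) :
    M ≅ N where
  hom := ({ toFun := e, map_add' := map_add e, map_smul' := h } : M →ₗ[A] N)
  inv := ({ toFun := e.symm, map_add' := map_add e.symm, map_smul' := fun a n => by
              apply e.injective; simp [h] } : N →ₗ[A] M)
  hom_inv_id := LinearMap.ext fun m => e.symm_apply_apply m
  inv_hom_id := LinearMap.ext fun n => e.apply_symm_apply n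

/-- The usual associativity isomorphism `(m ⊗ n) ⊗ p ↦ m ⊗ (n ⊗ p)`. -/
noncomputable def associatorIso (M N P : BialgModCat k A) :
    tensorObj (tensorObj M N) P ≅ tensorObj M (tensorObj N P) :=
  mkIso (TensorProduct.assoc k M N P) fun a x => by
    change TensorProduct.assoc k M N P (tensorAction (k := k) (tensorObj M N) P a x) =
      tensorAction (k := k) M (tensorObj N P) a (TensorProduct.assoc k M N P x)
    let F : (M ⊗[k] N) ⊗[k] P →ₗ[k] M ⊗[k] (N ⊗[k] P) :=
      (TensorProduct.assoc k M N P).toLinearMap ∘ₗ tensorAction (k := k) (tensorObj M N) P a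
    let G : (M ⊗[k] N) ⊗[k] P →ₗ[k] M ⊗[k] (N ⊗[k] P) :=
      tensorAction (k := k) M (tensorObj N P) a ∘ₗ (TensorProduct.assoc k M N P).toLinearMap
    suffices h : F = G from LinearMap.congr_fun h x
    apply TensorProduct.ext_threefold
    intro m n p
    let f := (LinearMap.toSpanSingleton A M m).restrictScalars k
    let g := (LinearMap.toSpanSingleton A N n).restrictScalars k
    let h := (LinearMap.toSpanSingleton A P p).restrictScalars k
    let E : A ⊗[k] (A ⊗[k] A) →ₗ[k] M ⊗[k] (N ⊗[k] P) :=
      TensorProduct.map f (TensorProduct.map g h)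
    let L₁ : A ⊗[k] A →ₗ[k] M ⊗[k] (N ⊗[k] P) := (TensorProduct.assoc k M N P).toLinearMap ∘ₗ
      TensorProduct.map ((LinearMap.toSpanSingleton A (tensorObj M N)
        (m ⊗ₜ[k] n : M ⊗[k] N)).restrictScalars k) h
    let L₂ : A ⊗[k] A →ₗ[k] M ⊗[k] (N ⊗[k] P) :=
      TensorProduct.map f ((LinearMap.toSpanSingleton A (tensorObj N P)
        (n ⊗ₜ[k] p : N ⊗[k] P)).restrictScalars k)
    have h₁ : L₁ = E ∘ₗ (TensorProduct.assoc k A A A).toLinearMap ∘ₗ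
        Coalgebra.comul.rTensor A := by
      apply TensorProduct.ext'
      intro u v
      change TensorProduct.assoc k M N P (tensorAction (k := k) M N u (m ⊗ₜ n) ⊗ₜ h v) =
        E (TensorProduct.assoc k A A A (Coalgebra.comul u ⊗ₜ v))
      rw [tensorAction_tmul]
      induction Coalgebra.comul (R := k) u with
      | zero => simp
      | add u v hu hv => simp only [map_add, TensorProduct.add_tmul, hu, hv]
      | tmul u v => rfl
    have h₂ : L₂ = E ∘ₗ Coalgebra.comul.lTensor A := by
      apply TensorProduct.ext'
      intro u v
      change f u ⊗ₜ tensorAction (k := k) N P v (n ⊗ₜ p) =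
        f u ⊗ₜ TensorProduct.map g h (Coalgebra.comul v)
      rw [tensorAction_tmul]
    change TensorProduct.assoc k M N P (tensorAction (k := k) (tensorObj M N) P a
        ((m ⊗ₜ[k] n : M ⊗[k] N) ⊗ₜ p)) =
      tensorAction (k := k) M (tensorObj N P) a (m ⊗ₜ (n ⊗ₜ[k] p : N ⊗[k] P))
    have h1 := tensorAction_tmul k A (M := tensorObj M N) (N := P) a (m ⊗ₜ[k] n : M ⊗[k] N) p
    have h2 := tensorAction_tmul k A (M := M) (N := tensorObj N P) a m (n ⊗ₜ[k] p : N ⊗[k] P)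
    exact (congrArg _ h1).trans ((LinearMap.congr_fun h₁ _).trans
      ((congrArg E (Coalgebra.coassoc_apply a)).trans
        ((LinearMap.congr_fun h₂ _).symm.trans h2.symm)))

/-- The usual isomorphism `c ⊗ m ↦ c m`. -/
noncomputable def leftUnitorIso (M : BialgModCat k A) : tensorObj (unitObj k A) M ≅ M :=
  mkIso (TensorProduct.lid k M) fun a x => by
    let F : k ⊗[k] M →ₗ[k] M :=
      (TensorProduct.lid k M).toLinearMap ∘ₗ tensorAction (k := k) (unitObj k A) M a
    let G : k ⊗[k] M →ₗ[k] M := Algebra.lsmul k k M a ∘ₗ (TensorProduct.lid k M).toLinearMap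
    suffices h : F = G from LinearMap.congr_fun h x
    apply TensorProduct.ext'
    intro c m
    let L : A ⊗[k] A →ₗ[k] M := (TensorProduct.lid k M).toLinearMap ∘ₗ
      TensorProduct.map ((LinearMap.toSpanSingleton A (unitObj k A) (c : k)).restrictScalars k)
        ((LinearMap.toSpanSingleton A M m).restrictScalars k)
    have hL : L = c • (LinearMap.toSpanSingleton A M m).restrictScalars k ∘ₗ
        (TensorProduct.lid k A).toLinearMap ∘ₗ Coalgebra.counit.rTensor A := by
      apply TensorProduct.ext'
      intro u v
      change (Coalgebra.counit (R := k) u * c) • v • m =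
        c • (Coalgebra.counit (R := k) u • v) • m
      rw [mul_comm, mul_smul, smul_assoc]
    have h1 := tensorAction_tmul k A (M := unitObj k A) (N := M) a (c : k) m
    refine (congrArg (TensorProduct.lid k M) h1).trans ((LinearMap.congr_fun hL _).trans ?_)
    change c • (TensorProduct.lid k A (Coalgebra.counit.rTensor A (Coalgebra.comul a))) • m = a • c • m
    rw [Coalgebra.rTensor_counit_comul]
    change c • ((1 : k) • a) • m = a • c • m
    rw [one_smul, smul_comm]

/-- The usual isomorphism `m ⊗ c ↦ c m`. -/
noncomputable def rightUnitorIso (M : BialgModCat k A) : tensorObj M (unitObj k A) ≅ M :=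
  mkIso (TensorProduct.rid k M) fun a x => by
    let F : M ⊗[k] k →ₗ[k] M :=
      (TensorProduct.rid k M).toLinearMap ∘ₗ tensorAction (k := k) M (unitObj k A) a
    let G : M ⊗[k] k →ₗ[k] M := Algebra.lsmul k k M a ∘ₗ (TensorProduct.rid k M).toLinearMap
    suffices h : F = G from LinearMap.congr_fun h x
    apply TensorProduct.ext'
    intro m c
    let L : A ⊗[k] A →ₗ[k] M := (TensorProduct.rid k M).toLinearMap ∘ₗ
      TensorProduct.map ((LinearMap.toSpanSingleton A M m).restrictScalars k)
        ((LinearMap.toSpanSingleton A (unitObj k A) (c : k)).restrictScalars k)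
    have hL : L = c • (LinearMap.toSpanSingleton A M m).restrictScalars k ∘ₗ
        (TensorProduct.rid k A).toLinearMap ∘ₗ Coalgebra.counit.lTensor A := by
      apply TensorProduct.ext'
      intro u v
      change (Coalgebra.counit (R := k) v * c) • u • m =
        c • (Coalgebra.counit (R := k) v • u) • m
      rw [mul_comm, mul_smul, smul_assoc]
    have h1 := tensorAction_tmul k A (M := M) (N := unitObj k A) a m (c : k)
    refine (congrArg (TensorProduct.rid k M) h1).trans ((LinearMap.congr_fun hL _).trans ?_)
    change c • (TensorProduct.rid k A (Coalgebra.counit.lTensor A (Coalgebra.comul a))) • m = a • c • m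
    rw [Coalgebra.lTensor_counit_comul]
    change c • ((1 : k) • a) • m = a • c • m
    rw [one_smul, smul_comm]

noncomputable instance : MonoidalCategoryStruct (BialgModCat k A) where
  tensorObj := tensorObj
  whiskerLeft M _ _ f := tensorMap (𝟙 M) f
  whiskerRight f N := tensorMap f (𝟙 N)
  tensorHom := tensorMap
  tensorUnit := unitObj k A
  associator := associatorIso
  leftUnitor := leftUnitorIso
  rightUnitor := rightUnitorIso

/-- The forgetful functor to `k`-vector spaces. -/
def toVect : BialgModCat k A ⥤ ModuleCat.{u} k where
  obj M := ModuleCat.of k M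
  map {M N} f := ModuleCat.ofHom (LinearMap.restrictScalars k (f : M →ₗ[A] N))

instance : (toVect (k := k) (A := A)).Faithful where
  map_injective {M N f g} h := by
    apply LinearMap.ext
    intro x
    exact congr($(h) x)

noncomputable instance : MonoidalCategory (BialgModCat k A) :=
  Monoidal.induced toVect
    { μIso := fun M N => Iso.refl _
      εIso := Iso.refl _
      whiskerLeft_eq := fun M N P f => by 
        apply ModuleCat.hom_ext; rfl
      whiskerRight_eq := fun f N => by 
        apply ModuleCat.hom_ext; rfl
      tensorHom_eq := fun f g => by 
        apply ModuleCat.hom_ext; rfl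
      associator_eq := fun M N P => by
        apply ModuleCat.hom_ext
        apply TensorProduct.ext_threefold
        intros; rfl
      leftUnitor_eq := fun M => by
        apply ModuleCat.hom_ext
        apply TensorProduct.ext'
        intros; rfl
      rightUnitor_eq := fun M => by
        apply ModuleCat.hom_ext
        apply TensorProduct.ext'
        intros; rfl }

end BialgModCat

/-- The Hopf algebras `A` and `B` are Morita-monoidally equivalent: there is a `k`-linear
equivalence between their categories of left modules which is a (strong) monoidal functor. -/
def MoritaMonoidallyEquivalent (k A B : Type u) [Field k] [Ring A] [HopfAlgebra k A]
    [Ring B] [HopfAlgebra k B] : Prop :=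
  ∃ e : BialgModCat k A ≌ BialgModCat k B,
    e.functor.Linear k ∧ Nonempty e.functor.Monoidal

/-! Since `Λ` is basic and split, its simple modules are one-dimensional, i.e. given by characters
`χ : Λ →ₐ[k] k`. Composing `χ` with the antipode gives a tensor inverse of `k_χ`. A strong monoidal
functor `F` preserves this invertibility and dimension is multiplicative, so `F(k_χ)` is again
one-dimensional (`finrank_obj_ofCharacter`). Let `Q` be the `Λ`-module corresponding to the regular
`Λ'`-module. It is projective and `Hom(Q, M)` is identified with `F(M)`, so `Hom(Q, k_χ)` is a line
for every `χ`. The regular module `Λ` has the same property, and a projective module is determined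
by its top, so `Q ≅ Λ` (`nonempty_linearEquiv_of_characters`). Comparing endomorphism algebras of
the regular modules gives `Λ ≅ Λ'`. -/

/-! ### Characters and projective modules over a finite dimensional algebra. -/

section Algebra

/-- A nonzero module over a semiprimary ring has a maximal submodule. -/
theorem IsSemiprimaryRing.exists_isCoatom (R : Type*) [Ring R] [IsSemiprimaryRing R] (M : Type u)
    [AddCommGroup M] [Module R M] [Nontrivial M] : ∃ m : Submodule R M, IsCoatom m := by
  refine IsSemiprimaryRing.induction R R M
    (P := fun M _ _ _ => Nontrivial M → ∃ m : Submodule R M, IsCoatom m) ?_ ?_ ‹_›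
  · intro M _ _ _ _ _ _ _
    obtain ⟨m, hm, -⟩ := (eq_top_or_exists_le_coatom (⊥ : Submodule R M)).resolve_left bot_ne_top
    exact ⟨m, hm⟩
  · intro M _ _ _ _ N hN hQ hM
    -- A maximal submodule of `M ⧸ N` pulls back to `M`; only when this quotient vanishes is `N`
    -- itself needed.
    by_cases h : N = ⊤
    · rw [h] at hN
      obtain ⟨m, hm⟩ := hN (Submodule.topEquiv (R := R) (M := M)).toEquiv.nontrivial
      exact ⟨_, ((Submodule.orderIsoMapComap
        (Submodule.topEquiv (R := R) (M := M))).isCoatom_iff m).2 hm⟩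
    · obtain ⟨m, hm⟩ := hQ (Submodule.Quotient.nontrivial_iff.2 h)
      exact ⟨m.comap N.mkQ, (Submodule.isCoatom_comap_iff N.mkQ_surjective).2 hm⟩

variable {k A : Type u} [Field k] [Ring A] [Algebra k A]

/-- If a simple module `S` occurs once in a semisimple module `M`, then nonzero maps `M → S`
differ by an endomorphism of `S`. -/
theorem exists_end_comp_eq {R M S : Type u} [Ring R] [AddCommGroup M] [Module R M]
    [IsSemisimpleModule R M] [AddCommGroup S] [Module R S] [IsSimpleModule R S]
    (h : simpleMultiplicity R M S = 1) (f g : M →ₗ[R] S) (hf : f ≠ 0) :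
    ∃ c : Module.End R S, g = c ∘ₗ f := by
  set I := isotypicComponent R M S
  have hI : IsSimpleModule R I := Module.length_eq_one_iff.1 h
  -- A nonzero map to `S` is a split surjection, and its section lands in the isotypic component
  -- `I`; so maps to `S` are determined on `I`.
  have key (φ : M →ₗ[R] S) (hφ : φ ∘ₗ I.subtype = 0) : φ = 0 := by
    by_contra h0
    obtain ⟨σ, hσ⟩ := IsSemisimpleModule.lifting_property φ
      (LinearMap.surjective_of_ne_zero h0) LinearMap.id
    have hinj : Function.Injective σ := fun x y hxy => by
      simpa [← LinearMap.comp_apply, hσ] using congrArg φ hxy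
    have hle : LinearMap.range σ ≤ I := le_sSup ⟨(LinearEquiv.ofInjective σ hinj).symm⟩
    have := IsSimpleModule.nontrivial R S
    obtain ⟨s, hs⟩ := exists_ne (0 : S)
    apply hs
    have h1 := LinearMap.congr_fun hφ ⟨σ s, hle ⟨s, rfl⟩⟩
    have h2 := LinearMap.congr_fun hσ s
    exact h2.symm.trans h1
  have hfI : f ∘ₗ I.subtype ≠ 0 := fun h => hf (key f h)
  let e := LinearEquiv.ofBijective _ (LinearMap.bijective_of_ne_zero hfI)
  refine ⟨(g ∘ₗ I.subtype) ∘ₗ e.symm, ?_⟩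
  rw [← sub_eq_zero]
  apply key
  ext x
  have : e.symm (f x) = x := e.symm_apply_apply x
  simp [this]

/-- Over a split basic finite dimensional algebra the simple modules have dimension one. -/
theorem finrank_eq_one_of_isSimpleModule [FiniteDimensional k A] (hbasic : IsBasicAlgebra A)
    (hsplit : IsSplitAlgebra k A) (S : Type u) [AddCommGroup S] [Module k S] [Module A S]
    [IsScalarTower k A S] [IsSimpleModule A S] : Module.finrank k S = 1 := by
  have : IsArtinianRing A := IsArtinianRing.of_finite k A
  have hss : IsSemisimpleModule A (A ⧸ Ring.jacobson A) :=
    (IsArtinian.isSemisimpleModule_iff_jacobson _ _).2 (Module.jacobson_quotient_jacobson A A)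
  have := IsSimpleModule.nontrivial A S
  obtain ⟨s, hs⟩ := exists_ne (0 : S)
  refine finrank_eq_one s hs fun t => ?_
  -- The radical kills `S`, so `1 ↦ t` factors through the quotient. Multiplicity one gives `t = c
  -- s` for an endomorphism `c`, and splitness makes `c` a scalar.
  let φ (t : S) : (A ⧸ Ring.jacobson A) →ₗ[A] S :=
    (Ring.jacobson A).liftQ (LinearMap.toSpanSingleton A S t)
      (IsSemisimpleModule.jacobson_le_ker A A A S _)
  have hφ (t : S) : φ t (Submodule.Quotient.mk 1) = t := one_smul A t
  obtain ⟨c, hc⟩ := exists_end_comp_eq (hbasic S ‹_›) (φ s) (φ t) fun h => hs (by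
    rw [← hφ s, h]; rfl)
  obtain ⟨e⟩ := hsplit S ‹_›
  refine ⟨e c, ?_⟩
  have h1 : algebraMap k (Module.End A S) (e c) = c := by
    apply e.injective
    rw [AlgEquiv.commutes]; rfl
  have h2 := congrArg (fun f => f (Submodule.Quotient.mk 1)) hc
  simp only [LinearMap.comp_apply, hφ] at h2
  rw [h2, ← LinearMap.congr_fun h1 s]
  rfl

/-- The character by which an algebra acts on a one-dimensional module. -/
theorem exists_character (S : Type u) [AddCommGroup S] [Module k S] [Module A S]
    [IsScalarTower k A S] (hS : Module.finrank k S = 1) :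
    ∃ χ : A →ₐ[k] k, ∀ (a : A) (s : S), a • s = χ a • s := by
  have := Module.finite_of_finrank_eq_succ hS
  obtain ⟨b⟩ := Module.nonempty_linearEquiv_of_finrank_eq_one (R := k) (M := Module.End k S)
    ((Module.finrank_linearMap k k S S).trans (by rw [hS]))
  have hE := bijective_algebraMap_of_linearEquiv b
  let e := AlgEquiv.ofBijective (Algebra.ofId k (Module.End k S)) hE
  refine ⟨e.symm.toAlgHom.comp (Algebra.lsmul k k S), fun a s => ?_⟩
  have : e (e.symm (Algebra.lsmul k k S a)) = Algebra.lsmul k k S a := e.apply_symm_apply _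
  exact (LinearMap.congr_fun this s).symm

open Classical in
/-- Characters of a finite dimensional algebra admit dual vectors. -/
theorem exists_dual_characters [FiniteDimensional k A] :
    ∃ (_ : Fintype (A →ₐ[k] k)) (a : (A →ₐ[k] k) → A),
      ∀ χ ψ : A →ₐ[k] k, χ (a ψ) = if χ = ψ then 1 else 0 := by
  classical
  -- Dedekind's independence of characters; dually, the evaluation vectors `(χ a)_χ` span.
  have hli : LinearIndependent k (fun χ : A →ₐ[k] k => (χ : A → k)) :=
    (linearIndependent_monoidHom A k).comp (fun χ : A →ₐ[k] k => (χ : A →* k))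
      fun _ _ h => AlgHom.ext fun a => congrArg (fun f : A →* k => f a) h
  have hli' : LinearIndependent k (fun χ : A →ₐ[k] k => χ.toLinearMap) :=
    LinearIndependent.of_comp (LinearMap.ltoFun k A k k) hli
  have := hli'.finite
  refine ⟨Fintype.ofFinite _, ?_⟩
  have h := span_flip_eq_top_iff_linearIndependent.2 hli
  let L : A →ₗ[k] ((A →ₐ[k] k) → k) := LinearMap.pi fun χ => χ.toLinearMap
  have hL : LinearMap.range L = ⊤ := by
    rw [eq_top_iff, ← h, Submodule.span_le]
    rintro _ ⟨a, rfl⟩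
    exact ⟨a, rfl⟩
  choose a ha using fun ψ : A →ₐ[k] k =>
    LinearMap.range_eq_top.1 hL (fun χ => if χ = ψ then 1 else 0)
  exact ⟨a, fun χ ψ => congrFun (ha ψ) χ⟩

/-- A projective module `Q` over a finite dimensional algebra whose simple modules have dimension
one is free of rank one as soon as it maps to every character, uniquely up to scalars. -/
theorem nonempty_linearEquiv_of_characters [FiniteDimensional k A]
    (hA : ∀ (S : Type u) [AddCommGroup S] [Module k S] [Module A S] [IsScalarTower k A S],
      IsSimpleModule A S → Module.finrank k S = 1)
    {Q : Type u} [AddCommGroup Q] [Module k Q] [Module A Q] [IsScalarTower k A Q]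
    [Module.Projective A Q]
    (φ : (A →ₐ[k] k) → Q →ₗ[k] k) (hφ0 : ∀ χ, φ χ ≠ 0)
    (hφ : ∀ χ a q, φ χ (a • q) = χ a * φ χ q)
    (huniq : ∀ (χ : A →ₐ[k] k) (f : Q →ₗ[k] k), (∀ a q, f (a • q) = χ a * f q) →
      ∃ c : k, f = c • φ χ) :
    Nonempty (A ≃ₗ[A] Q) := by
  classical
  obtain ⟨_, d, hd⟩ := exists_dual_characters (k := k) (A := A)
  have : IsArtinianRing A := IsArtinianRing.of_finite k A
  have hlift (χ : A →ₐ[k] k) : ∃ g : Q →ₗ[A] A, ∀ q, χ (g q) = φ χ q := by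
    let _ : Module A k := Module.compHom k χ.toRingHom
    let p : A →ₗ[A] k := { toFun := χ, map_add' := map_add χ, map_smul' := map_mul χ }
    let f : Q →ₗ[A] k := { toFun := φ χ, map_add' := map_add _, map_smul' := hφ χ }
    obtain ⟨g, hg⟩ := Module.projective_lifting_property p f fun c =>
      ⟨algebraMap k A c, χ.commutes c⟩
    exact ⟨g, LinearMap.congr_fun hg⟩
  choose g hg using hlift
  -- The dual vectors `d χ` glue the separate lifts `g χ` into a single map with `χ ∘ G = φ χ` for
  -- all `χ`.
  let G : Q →ₗ[A] A := ∑ χ, (LinearMap.toSpanSingleton A A (d χ)) ∘ₗ g χ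
  have hG (χ : A →ₐ[k] k) (q : Q) : χ (G q) = φ χ q := by
    simp [G, hd, hg, LinearMap.sum_apply]
  have hsurj : Function.Surjective G := by
    rw [← LinearMap.range_eq_top]
    refine (eq_top_or_exists_le_coatom _).resolve_right ?_
    rintro ⟨m, hm, hle⟩
    have := isSimpleModule_iff_isCoatom.2 hm
    obtain ⟨χ, hχ⟩ := exists_character (A := A) (A ⧸ m) (hA _ this)
    apply hφ0 χ
    ext q
    have h1 : (Submodule.Quotient.mk (G q) : A ⧸ m) = 0 :=
      (Submodule.Quotient.mk_eq_zero m).2 (hle ⟨q, rfl⟩)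
    have h2 := hχ (G q) (Submodule.Quotient.mk 1)
    rw [← Submodule.Quotient.mk_smul, smul_eq_mul, mul_one, h1, hG] at h2
    refine (smul_eq_zero.1 h2.symm).resolve_right fun h3 => hm.1 ?_
    exact (Ideal.eq_top_iff_one m).2 ((Submodule.Quotient.mk_eq_zero m).1 h3)
  obtain ⟨q₀, hq₀⟩ := hsurj 1
  suffices hinj : Function.Injective G from ⟨(LinearEquiv.ofBijective G ⟨hinj, hsurj⟩).symm⟩
  rw [← LinearMap.ker_eq_bot]
  by_contra hK
  have := (Submodule.nontrivial_iff_ne_bot).2 hK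
  obtain ⟨m, hm⟩ := IsSemiprimaryRing.exists_isCoatom A (LinearMap.ker G)
  have hs := isSimpleModule_iff_isCoatom.2 hm
  have hrank := hA (LinearMap.ker G ⧸ m) hs
  obtain ⟨χ, hχ⟩ := exists_character (A := A) (LinearMap.ker G ⧸ m) hrank
  -- The projection `q ↦ q - G(q) q₀` onto the kernel, from the section `1 ↦ q₀` of `G`.
  let r : Q →ₗ[A] LinearMap.ker G :=
    (LinearMap.id - LinearMap.toSpanSingleton A Q q₀ ∘ₗ G).codRestrict _ fun q => by
      simp [hq₀]
  have hr (x : LinearMap.ker G) : r x = x := by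
    ext
    have : G x = 0 := x.2
    simp [r, this]
  obtain ⟨e'⟩ := Module.nonempty_linearEquiv_of_finrank_eq_one hrank
  let e := e'.symm
  -- By uniqueness `f` is a multiple of `φ χ = χ ∘ G`, so it vanishes on `ker G`; yet there it is
  -- the quotient map by the proper submodule `m`.
  let f : Q →ₗ[k] k := e.toLinearMap ∘ₗ (m.mkQ ∘ₗ r).restrictScalars k
  obtain ⟨c, hc⟩ := huniq χ f fun a q => by
    change e (m.mkQ (r (a • q))) = χ a * e (m.mkQ (r q))
    rw [map_smul, map_smul, hχ, map_smul, smul_eq_mul]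
  apply hm.1
  rw [eq_top_iff]
  intro x _
  rw [← Submodule.Quotient.mk_eq_zero, ← e.map_eq_zero_iff]
  have h1 := LinearMap.congr_fun hc x
  have h2 : f x = e (Submodule.Quotient.mk x) := by
    change e (m.mkQ (r x)) = _
    rw [hr]; rfl
  rw [← h2, h1, LinearMap.smul_apply, ← hG]
  have : G x = 0 := x.2
  simp [this]

end Algebra

namespace BialgModCat

open CategoryTheory MonoidalCategory TensorProduct

/-! ### Modules over a bialgebra: epimorphisms, characters, direct sums. -/

section Bialgebra

variable {k A : Type u} [Field k] [Ring A] [Bialgebra k A]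

/-- An `A`-linear map as a morphism of `BialgModCat k A`. -/
def ofLinearMap {M N : BialgModCat k A} (f : M →ₗ[A] N) : M ⟶ N := f

/-- The `A`-linear map underlying a morphism of `BialgModCat k A`. -/
def Hom.toLinearMap {M N : BialgModCat k A} (f : M ⟶ N) : M →ₗ[A] N := f

theorem hom_ext {M N : BialgModCat k A} {f g : M ⟶ N}
    (h : ∀ x, Hom.toLinearMap f x = Hom.toLinearMap g x) : f = g :=
  LinearMap.ext h

theorem toLinearMap_comp_apply {M N P : BialgModCat k A} (f : M ⟶ N) (g : N ⟶ P) (x : M) :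
    Hom.toLinearMap (f ≫ g) x = Hom.toLinearMap g (Hom.toLinearMap f x) := rfl

/-- An `A`-module, with the `k`-vector space structure obtained by restriction. -/
def ofModule (k A : Type u) [Field k] [Ring A] [Bialgebra k A] (M : Type u) [AddCommGroup M]
    [Module A M] : BialgModCat k A :=
  let _ : Module k M := Module.compHom M (algebraMap k A)
  { carrier := M
    isScalarTower := .of_algebraMap_smul fun _ _ => rfl }

/-- The left regular module. -/
def regular (k A : Type u) [Field k] [Ring A] [Bialgebra k A] : BialgModCat k A where
  carrier := A

/-- The one-dimensional module given by a character. -/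
def ofCharacter (χ : A →ₐ[k] k) : BialgModCat k A where
  carrier := k
  moduleAlgebra := Module.compHom k χ.toRingHom
  isScalarTower := by
    let this := Module.compHom k χ.toRingHom
    refine @IsScalarTower.mk k A k _ this.toSMul _ fun c a x => ?_
    change χ (c • a) * x = c * (χ a * x)
    rw [map_smul, smul_eq_mul, mul_assoc]

/-- Isomorphic objects have isomorphic underlying vector spaces. -/
def linearEquivOfIso {M N : BialgModCat k A} (i : M ≅ N) : M ≃ₗ[k] N :=
  (toVect.mapIso i).toLinearEquiv

/-- Isomorphic objects are isomorphic `A`-modules. -/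
def algLinearEquivOfIso {M N : BialgModCat k A} (i : M ≅ N) : M ≃ₗ[A] N :=
  { Hom.toLinearMap i.hom with
    invFun := Hom.toLinearMap i.inv
    left_inv := fun x => LinearMap.congr_fun (f := Hom.toLinearMap (i.hom ≫ i.inv))
      (g := Hom.toLinearMap (𝟙 M)) (by rw [i.hom_inv_id]) x
    right_inv := fun x => LinearMap.congr_fun (f := Hom.toLinearMap (i.inv ≫ i.hom))
      (g := Hom.toLinearMap (𝟙 N)) (by rw [i.inv_hom_id]) x }

theorem epi_of_surjective {M N : BialgModCat k A} (f : M ⟶ N)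
    (hf : Function.Surjective (Hom.toLinearMap f)) : Epi f where
  left_cancellation g h hgh := hom_ext fun y => by
    obtain ⟨x, rfl⟩ := hf y
    rw [← toLinearMap_comp_apply, hgh, toLinearMap_comp_apply]

/-- The projection to the cokernel and the zero map agree after `f`. Surjectivity thus becomes
categorical, hence preserved by equivalences. -/
theorem surjective_of_epi {M N : BialgModCat k A} (f : M ⟶ N) [Epi f] :
    Function.Surjective (Hom.toLinearMap f) := by
  let R := LinearMap.range (Hom.toLinearMap f)
  let C := ofModule k A (N ⧸ R)
  let p : N ⟶ C := ofLinearMap (N := C) R.mkQ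
  have h : p = ofLinearMap (N := C) 0 := by
    rw [← cancel_epi f]
    refine hom_ext fun x => ?_
    exact (Submodule.Quotient.mk_eq_zero R).2 ⟨x, rfl⟩
  intro y
  exact (Submodule.Quotient.mk_eq_zero R).1
    (LinearMap.congr_fun (f := Hom.toLinearMap p) (congrArg Hom.toLinearMap h) y)

/-- The tensor product of the modules given by two mutually inverse characters is trivial. -/
noncomputable def ofCharacterTensorIso (χ ψ : A →ₐ[k] k)
    (h : ∀ a, LinearMap.mul' k k (TensorProduct.map χ.toLinearMap ψ.toLinearMap
      (Coalgebra.comul (R := k) a)) = Coalgebra.counit (R := k) a) :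
    ofCharacter χ ⊗ ofCharacter ψ ≅ 𝟙_ (BialgModCat k A) :=
  mkIso (M := tensorObj (ofCharacter χ) (ofCharacter ψ)) (N := unitObj k A)
    (TensorProduct.lid k k) fun a x => by
    let T := tensorAction (k := k) (ofCharacter χ) (ofCharacter ψ) a
    let F : k ⊗[k] k →ₗ[k] k := (TensorProduct.lid k k).toLinearMap ∘ₗ T
    let G : k ⊗[k] k →ₗ[k] k :=
      Coalgebra.counit (R := k) a • (TensorProduct.lid k k).toLinearMap
    suffices h : F = G from LinearMap.congr_fun h x
    apply TensorProduct.ext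
    ext
    change TensorProduct.lid k k (T ((1 : k) ⊗ₜ (1 : k))) =
      Coalgebra.counit (R := k) a • TensorProduct.lid k k (1 ⊗ₜ 1)
    have h1 := tensorAction_tmul k A (M := ofCharacter χ) (N := ofCharacter ψ) a (1 : k) (1 : k)
    have h2 : TensorProduct.lid k k (T ((1 : k) ⊗ₜ (1 : k))) = _ := congrArg (TensorProduct.lid k k) h1
    have h3 : (TensorProduct.lid k k).toLinearMap ∘ₗ TensorProduct.map
        ((LinearMap.toSpanSingleton A (ofCharacter χ) (1 : k)).restrictScalars k)
        ((LinearMap.toSpanSingleton A (ofCharacter ψ) (1 : k)).restrictScalars k) =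
        LinearMap.mul' k k ∘ₗ TensorProduct.map χ.toLinearMap ψ.toLinearMap := by
      apply TensorProduct.ext'
      intro u v
      change χ u * 1 * (ψ v * 1) = χ u * ψ v
      rw [mul_one, mul_one]
    have h4 : TensorProduct.lid k k ((1 : k) ⊗ₜ[k] (1 : k)) = 1 := by simp
    rw [h4, smul_eq_mul, mul_one, ← h a]
    exact h2.trans (LinearMap.congr_fun h3 _)

/-- The direct sum of two modules. -/
def prodBicone (M N : BialgModCat k A) : Limits.BinaryBicone M N where
  pt := { carrier := M × N }
  fst := LinearMap.fst A M N
  snd := LinearMap.snd A M N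
  inl := LinearMap.inl A M N
  inr := LinearMap.inr A M N
  inl_fst := LinearMap.fst_comp_inl A M N
  inl_snd := LinearMap.snd_comp_inl A M N
  inr_fst := LinearMap.fst_comp_inr A M N
  inr_snd := LinearMap.snd_comp_inr A M N

/-- Used to deduce that an equivalence is additive, since it preserves binary products. -/
instance : Limits.HasBinaryBiproducts (BialgModCat k A) where
  has_binary_biproduct M N := Limits.hasBinaryBiproduct_of_total (prodBicone M N) <|
    hom_ext fun x => Prod.fst_add_snd (M := M) (N := N) x

end Bialgebra

/-! ### Invertibility of characters via the antipode. -/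

section Hopf

variable {k A : Type u} [Field k] [Ring A] [HopfAlgebra k A]

/-- The composite of a character with the antipode. -/
noncomputable def antipodeCharacter (χ : A →ₐ[k] k) : A →ₐ[k] k :=
  AlgHom.ofLinearMap (χ.toLinearMap ∘ₗ HopfAlgebra.antipode k)
    (by simp [HopfAlgebra.antipode_one])
    -- The antipode reverses products, which is harmless because `k` is commutative.
    fun a b => by simp [HopfAlgebra.antipode_mul_antidistrib, mul_comm]

/-- The module given by a character is invertible. -/
noncomputable def ofCharacterTensorAntipodeIso (χ : A →ₐ[k] k) :
    ofCharacter χ ⊗ ofCharacter (antipodeCharacter χ) ≅ 𝟙_ (BialgModCat k A) :=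
  ofCharacterTensorIso χ (antipodeCharacter χ) fun a => by
    have h := congrArg χ (HopfAlgebra.mul_antipode_lTensor_comul_apply (R := k) a)
    rw [AlgHom.commutes] at h
    refine Eq.trans ?_ h
    induction Coalgebra.comul (R := k) a with
    | zero => simp
    | add u v hu hv => simp only [map_add, hu, hv]
    | tmul u v => exact (map_mul χ _ _).symm

end Hopf

section Monoidal

variable {k A B : Type u} [Field k] [Ring A] [HopfAlgebra k A] [Ring B] [HopfAlgebra k B]

/-- A strong monoidal functor sends characters to one-dimensional modules. -/
theorem finrank_obj_ofCharacter (F : BialgModCat k A ⥤ BialgModCat k B) [F.Monoidal]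
    (χ : A →ₐ[k] k) : Module.finrank k (F.obj (ofCharacter χ)) = 1 := by
  let i := Functor.Monoidal.μIso F (ofCharacter χ) (ofCharacter (antipodeCharacter χ)) ≪≫
    F.mapIso (ofCharacterTensorAntipodeIso χ) ≪≫ (Functor.Monoidal.εIso F).symm
  have h : Module.finrank k (F.obj (ofCharacter χ) ⊗[k] F.obj (ofCharacter (antipodeCharacter χ)))
      = Module.finrank k k := (linearEquivOfIso i).finrank_eq
  -- `finrank` is `0` in infinite dimension, so a product equal to `1` also excludes
  -- infinite-dimensional factors.
  rw [Module.finrank_tensorProduct, Module.finrank_self] at h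
  exact Nat.eq_one_of_mul_eq_one_right h

end Monoidal

/-! ### The module corresponding to the regular module. -/

section Equivalence

variable {k A B : Type u} [Field k] [Ring A] [Bialgebra k A] [Ring B] [Bialgebra k B]
  (e : BialgModCat k A ≌ BialgModCat k B)

/-- The module corresponding to the regular `B`-module represents the underlying set of
`e.functor`. -/
noncomputable def generator : e.functor.obj (e.inverse.obj (regular k B)) :=
  Hom.toLinearMap (e.counitIso.inv.app (regular k B)) (1 : B)

/-- With `generator_surjective`, this is the bijection `Hom(Q, M) ≅ Hom(B, F M) ≅ F M`: a map out of
the regular module is determined by the image of `1`, which is arbitrary. -/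
theorem generator_injective {M : BialgModCat k A} {f g : e.inverse.obj (regular k B) ⟶ M}
    (h : Hom.toLinearMap (e.functor.map f) (generator e) =
      Hom.toLinearMap (e.functor.map g) (generator e)) : f = g := by
  apply e.functor.map_injective
  rw [← cancel_epi (e.counitIso.inv.app (regular k B))]
  exact LinearMap.ext_ring (M₃ := e.functor.obj M) h

theorem generator_surjective {M : BialgModCat k A} (t : e.functor.obj M) :
    ∃ f : e.inverse.obj (regular k B) ⟶ M,
      Hom.toLinearMap (e.functor.map f) (generator e) = t := by
  let s : regular k B ⟶ e.functor.obj M :=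
    ofLinearMap (M := regular k B) (LinearMap.toSpanSingleton B _ t)
  refine ⟨e.functor.preimage (e.counitIso.hom.app (regular k B) ≫ s), ?_⟩
  have h : e.counitIso.inv.app (regular k B) ≫
      e.functor.map (e.functor.preimage (e.counitIso.hom.app (regular k B) ≫ s)) = s := by
    rw [Functor.map_preimage, Iso.inv_hom_id_app_assoc]
  exact (congrArg (fun f => Hom.toLinearMap f (1 : B)) h).trans (one_smul B t)

/-- The module corresponding to the regular `B`-module is projective. -/
theorem projective_inverse_obj_regular :
    Module.Projective A (e.inverse.obj (regular k B)) := by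
  let Q := e.inverse.obj (regular k B)
  refine Module.Projective.of_lifting_property'' fun p hp => ?_
  let M : BialgModCat k A := { carrier := Q →₀ A }
  let f : M ⟶ Q := ofLinearMap (M := M) p
  have := epi_of_surjective f hp
  -- A preimage of the generator corresponds to a map `Q ⟶ M`, which is the required section.
  obtain ⟨t, ht⟩ := surjective_of_epi (e.functor.map f) (generator e)
  obtain ⟨h, rfl⟩ := generator_surjective e t
  refine ⟨Hom.toLinearMap h, ?_⟩
  have h1 : h ≫ f = 𝟙 Q := generator_injective e <| by
    rw [e.functor.map_comp, toLinearMap_comp_apply, ht, e.functor.map_id]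
    rfl
  exact congrArg Hom.toLinearMap h1

/-- A fully faithful `k`-linear functor induces isomorphisms of endomorphism algebras. -/
noncomputable def endAlgEquiv (F : BialgModCat k A ⥤ BialgModCat k B) [F.Additive] [F.Linear k] [F.Full]
    [F.Faithful] (M : BialgModCat k A) : Module.End A M ≃ₐ[k] Module.End B (F.obj M) :=
  AlgEquiv.ofBijective
    (AlgHom.ofLinearMap (F.mapLinearMap k (X := M) (Y := M) : (M ⟶ M) →ₗ[k] (F.obj M ⟶ F.obj M))
      (F.map_id M) fun f g => F.map_comp (ofLinearMap g) (ofLinearMap f))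
    ⟨F.map_injective (X := M) (Y := M), F.map_surjective (X := M) (Y := M)⟩

variable {e} in
/-- If the regular modules correspond to each other, the algebras are isomorphic. -/
theorem nonempty_algEquiv_of_regular [e.functor.Additive] [e.functor.Linear k]
    (i : A ≃ₗ[A] e.inverse.obj (regular k B)) : Nonempty (A ≃ₐ[k] B) := by
  let j : regular k A ≅ e.inverse.obj (regular k B) :=
    mkIso (M := regular k A) (i.restrictScalars k) i.map_smul
  let l : e.functor.obj (regular k A) ≃ₗ[B] B :=
    algLinearEquivOfIso (e.functor.mapIso j ≪≫ e.counitIso.app (regular k B))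
  let E : Aᵐᵒᵖ ≃ₐ[k] Bᵐᵒᵖ := (AlgEquiv.moduleEndSelf k).trans <|
    (endAlgEquiv e.functor (regular k A)).trans <|
    (l.conjAlgEquiv k).trans (AlgEquiv.moduleEndSelf k).symm
  exact ⟨AlgEquiv.op.symm E⟩

variable {e} in
/-- If a `k`-linear equivalence sends one-dimensional modules to one-dimensional modules and all
simple `A`-modules are one-dimensional, then the regular modules correspond to each other. -/
theorem nonempty_linearEquiv_inverse_obj_regular [FiniteDimensional k A] [e.functor.Additive] [e.functor.Linear k]
    (hA : ∀ (S : Type u) [AddCommGroup S] [Module k S] [Module A S] [IsScalarTower k A S],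
      IsSimpleModule A S → Module.finrank k S = 1)
    (he : ∀ χ : A →ₐ[k] k, Module.finrank k (e.functor.obj (ofCharacter χ)) = 1) :
    Nonempty (A ≃ₗ[A] e.inverse.obj (regular k B)) := by
  have := projective_inverse_obj_regular e
  have hex (χ : A →ₐ[k] k) : ∃ f : e.inverse.obj (regular k B) ⟶ ofCharacter χ,
      Hom.toLinearMap (e.functor.map f) (generator e) ≠ 0 := by
    have := Module.nontrivial_of_finrank_eq_succ (he χ)
    obtain ⟨t, ht⟩ := exists_ne (0 : e.functor.obj (ofCharacter χ))
    obtain ⟨f, rfl⟩ := generator_surjective e t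
    exact ⟨f, ht⟩
  choose f hf using hex
  refine nonempty_linearEquiv_of_characters hA
    (fun χ => (Hom.toLinearMap (f χ)).restrictScalars k) (fun χ h => hf χ ?_)
    (fun χ a q => (Hom.toLinearMap (f χ)).map_smul a q) fun χ g hg => ?_
  · have h0 : f χ = 0 := hom_ext fun x => LinearMap.congr_fun h x
    rw [h0, e.functor.map_zero]
    rfl
  · let g' : e.inverse.obj (regular k B) ⟶ ofCharacter χ :=
      ofLinearMap (N := ofCharacter χ) { toFun := g, map_add' := map_add g, map_smul' := hg }
    -- On the line `F(k_χ)` the two images of the generator are proportional, hence so are the maps.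
    obtain ⟨c, hc⟩ := (finrank_eq_one_iff_of_nonzero' _ (hf χ)).1 (he χ)
      (Hom.toLinearMap (e.functor.map g') (generator e))
    have h : g' = c • f χ := generator_injective e <| by
      rw [e.functor.map_smul, ← hc]
      rfl
    exact ⟨c, LinearMap.ext fun q => congrArg (fun f => Hom.toLinearMap f q) h⟩

end Equivalence

end BialgModCat

theorem mainTheorem4 {k : Type u} [Field k] {Λ Λ' : Type u}
    [Ring Λ] [HopfAlgebra k Λ] [FiniteDimensional k Λ]
    [Ring Λ'] [HopfAlgebra k Λ']
    (hbasic : IsBasicAlgebra Λ) (hsplit : IsSplitAlgebra k Λ)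
    (h : MoritaMonoidallyEquivalent k Λ Λ') :
    Nonempty (Λ ≃ₐ[k] Λ') := by
  obtain ⟨e, _, ⟨_⟩⟩ := h
  have : e.functor.Additive :=
    CategoryTheory.Functor.additive_of_preserves_binary_products e.functor
  obtain ⟨i⟩ := BialgModCat.nonempty_linearEquiv_inverse_obj_regular (e := e)
    (fun S _ _ _ _ _ => finrank_eq_one_of_isSimpleModule hbasic hsplit S)
    (BialgModCat.finrank_obj_ofCharacter e.functor)
  exact BialgModCat.nonempty_algEquiv_of_regular i
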